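/- Let $\mathcal H_S$ and $\mathcal H_E$ be finite-dimensional complex Hilbert spaces (system and environment), let $|0\rangle\in\mathcal H_E$ be a unit vector, and let $\Phi$ be a quantum channel (completely positive trace-preserving linear map) on the operators on $\mathcal H_S$, with Stinespring representation $$\Phi(X)=\operatorname{Tr}_E\big(U\,(X\otimes|0\rangle\langle 0|)\,U^\dagger\big),$$ where $U$ is a unitary operator on $\mathcal H_S\otimes\mathcal H_E$ and $\operatorname{Tr}_E$ is the partial trace over $\mathcal H_E$. Let $T\in\mathbb R$ and let $H$ be a Hermitian operator on $\mathcal H_S\otimes\mathcal H_E$ with $U=e^{-iHT}$ and spectral decomposition $H=\sum_{i=0}^{M-1}\lambda_iP_i$, where $\lambda_0<\lambda_1<\dots<\lambda_{M-1}$ are real and $P_0,\dots,P_{M-1}$ are nonzero, mutually orthogonal projections with $\sum_iP_i=I$. For a permutation $s\in S_M$ of $\{0,\dots,M-1\}$ put $$H_s=\sum_{i=0}^{M-1}\lambda_iP_{s(i)},\qquad \Phi_s(X)=\operatorname{Tr}_E\big(e^{-iH_sT}\,(X\otimes|0\rangle\langle 0|)\,e^{iH_sT}\big).$$ For positive semidefinite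 operators let $D(\rho,\sigma)=\operatorname{Tr}\big[(\sqrt\rho-\sqrt\sigma)^2\big]$ (squared quantum Hellinger distance), for a state $\tau$ on $\mathcal H_S\otimes\mathcal H_E$ let $$C_{1/2}(\tau)=1-\sum_{i=0}^{M-1}\operatorname{Tr}\big[(P_i\sqrt\tau P_i)^2\big],$$ and let $$B(T)=\frac{2}{M(M-1)}\sum_{0\le m<n\le M-1}\cos\big((\lambda_m-\lambda_n)T\big)$$ (with $B(T)=0$ if $M=1$). Then for every state $\rho$ on $\mathcal H_S$ (positive semidefinite operator of trace $1$), $$\frac1{M!}\sum_{s\in S_M}D\big(\Phi_s(\rho),\rho\big)\le 2\,[1-B(T)]\,C_{1/2}\big(\rho\otimes|0\rangle\langle 0|\big).$$ -/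

import Mathlib

open scoped Kronecker ComplexOrder MatrixOrder Matrix

noncomputable section

/-- A density matrix (quantum state): positive semidefinite with trace one. -/
def IsDensityMatrix {ι : Type*} [Fintype ι] (ρ : Matrix ι ι ℂ) : Prop :=
  ρ.PosSemidef ∧ ρ.trace = 1

/-- The squared quantum Hellinger distance `D(ρ, σ) = Tr (√ρ - √σ)²`. The square roots of positive
semidefinite matrices are positive semidefinite, so the trace is a real number. -/
def hellingerDist {ι : Type*} [Fintype ι] [DecidableEq ι] (ρ σ : Matrix ι ι ℂ) : ℝ :=
  (((CFC.sqrt ρ - CFC.sqrt σ) ^ 2).trace).re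

/-- `P₀, …, P_{M-1}` are nonzero, mutually orthogonal projections with sum the identity. -/
structure IsOrthogonalDecomposition {κ : Type*} [Fintype κ] [DecidableEq κ] {M : ℕ}
    (P : Fin M → Matrix κ κ ℂ) : Prop where
  isHermitian : ∀ i, (P i).IsHermitian
  idempotent : ∀ i, P i * P i = P i
  ne_zero : ∀ i, P i ≠ 0
  orthogonal : ∀ i j, i ≠ j → P i * P j = 0
  sum_eq_one : ∑ i, P i = 1

/-- `H = ∑ i, λᵢ Pᵢ` is the spectral decomposition of `H`, with `λ₀ < λ₁ < ⋯ < λ_{M-1}`. -/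
structure IsSpectralDecomposition {κ : Type*} [Fintype κ] [DecidableEq κ] {M : ℕ}
    (H : Matrix κ κ ℂ) (lam : Fin M → ℝ) (P : Fin M → Matrix κ κ ℂ) : Prop where
  decomposition : IsOrthogonalDecomposition P
  strictMono : StrictMono lam
  eq_sum : H = ∑ i, (lam i : ℂ) • P i

/-- The permuted Hamiltonian `H_s = ∑ i, λᵢ P_{s(i)}`. -/
def permutedHamiltonian {κ : Type*} {M : ℕ}
    (lam : Fin M → ℝ) (P : Fin M → Matrix κ κ ℂ) (s : Equiv.Perm (Fin M)) : Matrix κ κ ℂ :=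
  ∑ i, (lam i : ℂ) • P (s i)

/-- The time evolution operator `e^{-iHt}`. -/
def timeEvolution {κ : Type*} [Fintype κ] [DecidableEq κ]
    (H : Matrix κ κ ℂ) (t : ℝ) : Matrix κ κ ℂ :=
  NormedSpace.exp ((-(Complex.I * (t : ℂ))) • H)

/-- The coherence `C_{1/2}(ρ) = 1 - ∑ i, Tr [(Pᵢ √ρ Pᵢ)²]` of `ρ` under `P₀, …, P_{M-1}`. -/
def coherenceHalf {κ : Type*} [Fintype κ] [DecidableEq κ] {M : ℕ}
    (P : Fin M → Matrix κ κ ℂ) (ρ : Matrix κ κ ℂ) : ℝ :=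
  1 - ∑ i, (((P i * CFC.sqrt ρ * P i) ^ 2).trace).re

/-- `B(t) = 2 / (M (M - 1)) * ∑_{m < n} cos ((λ_m - λ_n) t)`. For `M = 1` the sum is empty
and the value is `0`. -/
def cosAverage {M : ℕ} (lam : Fin M → ℝ) (t : ℝ) : ℝ :=
  2 / ((M : ℝ) * ((M : ℝ) - 1)) *
    ∑ m : Fin M, ∑ n ∈ Finset.Ioi m, Real.cos ((lam m - lam n) * t)

/-- The partial trace `Tr_E` over the second tensor factor. -/
def partialTraceEnv {ι κ : Type*} [Fintype κ] (X : Matrix (ι × κ) (ι × κ) ℂ) : Matrix ι ι ℂ :=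
  Matrix.of fun i j => ∑ k, X (i, k) (j, k)

/-- The composite operator `X ⊗ |e⟩⟨e|`. -/
def withEnv {ι κ : Type*} (e : κ → ℂ) (X : Matrix ι ι ℂ) : Matrix (ι × κ) (ι × κ) ℂ :=
  X ⊗ₖ Matrix.vecMulVec e (star e)

/-- The map `X ↦ Tr_E (V (X ⊗ |e⟩⟨e|) V†)`. -/
def stinespringMap {ι κ : Type*} [Fintype ι] [Fintype κ]
    (e : κ → ℂ) (V : Matrix (ι × κ) (ι × κ) ℂ) (X : Matrix ι ι ℂ) : Matrix ι ι ℂ :=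
  partialTraceEnv (V * withEnv e X * Vᴴ)

/-- The amplification `Φ ⊗ id_n`: it applies `Φ` to each of the `n × n` blocks of `X`. -/
def amplify {ι : Type*} (Φ : Matrix ι ι ℂ →ₗ[ℂ] Matrix ι ι ℂ) (n : ℕ)
    (X : Matrix (ι × Fin n) (ι × Fin n) ℂ) : Matrix (ι × Fin n) (ι × Fin n) ℂ :=
  Matrix.of fun p q => Φ (Matrix.of fun k l => X (k, p.2) (l, q.2)) p.1 q.1

/-- A quantum channel: a completely positive trace preserving linear map. -/
structure IsQuantumChannel {ι : Type*} [Fintype ι]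
    (Φ : Matrix ι ι ℂ →ₗ[ℂ] Matrix ι ι ℂ) : Prop where
  completelyPositive : ∀ (n : ℕ) (X : Matrix (ι × Fin n) (ι × Fin n) ℂ),
    X.PosSemidef → (amplify Φ n X).PosSemidef
  tracePreserving : ∀ X : Matrix ι ι ℂ, (Φ X).trace = X.trace

end

/-!
Every step except one is an equality. Write `τ = ρ ⊗ |e⟩⟨e|`, `R = √τ` and
`V_s = e^{-i H_s T} = ∑ i, e^{-i λ_i T} P_{s i}`. On states `D(A, B) = 2 - 2 Tr √A √B`, and
`√(V τ Vᴴ) = V R Vᴴ` for a unitary `V`, so `D(V_s τ V_sᴴ, τ)` is determined by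
`Tr (V_s R V_sᴴ R) = ∑ i j, cos ((λ_i - λ_j) T) g (s i) (s j)`, where `g k l = Tr (P_k R P_l R)`.
The numbers `g k l` add up to `Tr τ = 1`, and the diagonal ones to `1 - C_{1/2}(τ)`. Averaging over
`s` keeps the diagonal part and, by double transitivity of the symmetric group, replaces each
`g (s i) (s j)` with `i ≠ j` by the mean off-diagonal value `C_{1/2}(τ) / (M (M - 1))`
(`sum_perm_pair_eq`). The average of the trace is `1 - C_{1/2}(τ) + B(T) C_{1/2}(τ)`, which gives the
right-hand side exactly.

The inequality is the monotonicity of `D` under `Tr_E`, that is `Tr √A √τ ≤ Tr √(Tr_E A) √ρ`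
(`re_trace_sqrt_mul_sqrt_withEnv_le`). Because the environment part of `τ` is pure, it has a direct
proof. Let `W x = x ⊗ e`, an isometry with `√τ = W √ρ Wᴴ`; the left-hand side is `Tr K √ρ` for
`K = Wᴴ √A W`. Since `W Wᴴ ≤ 1`, we have `K² ≤ Wᴴ A W ≤ Tr_E A`, and operator monotonicity of the
square root gives `K ≤ √(Tr_E A)`.
-/

open Finset Matrix

/-! ### Compression by an isometry and the partial trace -/

section Isometry

variable {m n : Type*} [Fintype m] [Fintype n]

theorem conj_nonneg {A : Matrix n n ℂ} (hA : 0 ≤ A) (W : Matrix m n ℂ) : 0 ≤ W * A * Wᴴ :=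
  (hA.posSemidef.mul_mul_conjTranspose_same W).nonneg

theorem sqrt_conj_isometry [DecidableEq m] [DecidableEq n] {A : Matrix n n ℂ} (hA : 0 ≤ A)
    {W : Matrix m n ℂ} (hW : Wᴴ * W = 1) :
    CFC.sqrt (W * A * Wᴴ) = W * CFC.sqrt A * Wᴴ := by
  refine CFC.sqrt_unique ?_ (conj_nonneg (CFC.sqrt_nonneg A) W)
  calc W * CFC.sqrt A * Wᴴ * (W * CFC.sqrt A * Wᴴ)
      = W * CFC.sqrt A * (Wᴴ * W) * CFC.sqrt A * Wᴴ := by simp only [Matrix.mul_assoc]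
    _ = W * (CFC.sqrt A * CFC.sqrt A) * Wᴴ := by
      rw [hW, Matrix.mul_one, Matrix.mul_assoc W]
    _ = W * A * Wᴴ := by rw [CFC.sqrt_mul_sqrt_self A hA]

theorem trace_conj_isometry [DecidableEq n] (A : Matrix n n ℂ) {W : Matrix m n ℂ} (hW : Wᴴ * W = 1) :
    (W * A * Wᴴ).trace = A.trace := by
  rw [trace_mul_comm, ← Matrix.mul_assoc, hW, Matrix.one_mul]

theorem one_sub_mul_conjTranspose_nonneg [DecidableEq m] [DecidableEq n]
    {W : Matrix m n ℂ} (hW : Wᴴ * W = 1) :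
    0 ≤ 1 - W * Wᴴ := by
  have h : (1 - W * Wᴴ)ᴴ * (1 - W * Wᴴ) = 1 - W * Wᴴ := by
    have h2 : W * Wᴴ * (W * Wᴴ) = W * Wᴴ := by
      rw [Matrix.mul_assoc, ← Matrix.mul_assoc Wᴴ, hW, Matrix.one_mul]
    simp [Matrix.sub_mul, Matrix.mul_sub, h2]
  rw [← h]
  exact (posSemidef_conjTranspose_mul_self _).nonneg

open scoped Matrix.Norms.L2Operator in
/-- Operator monotonicity of the square root, in the form used here: `K ^ 2 ≤ A` and `0 ≤ K` imply
`K ≤ √A`. -/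
theorem le_sqrt_of_mul_self_le [DecidableEq n] {K A : Matrix n n ℂ} (hK : 0 ≤ K) (h : K * K ≤ A) :
    K ≤ CFC.sqrt A := by
  rw [← CFC.sqrt_mul_self K hK]
  exact CFC.sqrt_le_sqrt _ _ h

/-- The compression of `√A` by an isometry is at most the square root of the compression: since
`W Wᴴ ≤ 1`, its square is at most `Wᴴ A W`. -/
theorem mul_self_compress_sqrt_le [DecidableEq m] [DecidableEq n] {A : Matrix m m ℂ} (hA : 0 ≤ A)
    {W : Matrix m n ℂ} (hW : Wᴴ * W = 1) :
    (Wᴴ * CFC.sqrt A * W) * (Wᴴ * CFC.sqrt A * W) ≤ Wᴴ * A * W := by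
  have hR : (CFC.sqrt A)ᴴ = CFC.sqrt A := (CFC.sqrt_nonneg A).posSemidef.isHermitian
  have h := conj_nonneg (one_sub_mul_conjTranspose_nonneg hW) (Wᴴ * CFC.sqrt A)
  have hAW : Wᴴ * A * W = Wᴴ * (CFC.sqrt A * CFC.sqrt A) * W := by
    rw [CFC.sqrt_mul_sqrt_self A hA]
  rw [← sub_nonneg, hAW]
  convert h using 1
  simp only [conjTranspose_mul, conjTranspose_conjTranspose, hR, Matrix.mul_sub, Matrix.sub_mul,
    Matrix.mul_one, Matrix.mul_assoc]

theorem re_trace_mul_le_of_le [DecidableEq n] {A B C : Matrix n n ℂ} (hAB : A ≤ B) (hC : 0 ≤ C) :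
    (A * C).trace.re ≤ (B * C).trace.re := by
  have hR : (CFC.sqrt C)ᴴ = CFC.sqrt C := (CFC.sqrt_nonneg C).posSemidef.isHermitian
  have h := (conj_nonneg (sub_nonneg.2 hAB) (CFC.sqrt C)).posSemidef.trace_nonneg
  rw [hR, trace_mul_comm, ← Matrix.mul_assoc, CFC.sqrt_mul_sqrt_self C hC, trace_mul_comm,
    Matrix.sub_mul, trace_sub] at h
  have := (Complex.le_def.1 h).1
  simpa using this

end Isometry

section PartialTrace

variable {ι κ : Type*}

/-- The matrix of the map `x ↦ x ⊗ e` from the system into the composite system. It is an isometry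
when `e` is a unit vector. -/
def envEmbedding (ι : Type*) [DecidableEq ι] {κ : Type*} (e : κ → ℂ) : Matrix (ι × κ) ι ℂ :=
  Matrix.of fun p j => if p.1 = j then e p.2 else 0

theorem conjTranspose_envEmbedding_mul_self [Fintype ι] [DecidableEq ι] [Fintype κ] {e : κ → ℂ}
    (he : star e ⬝ᵥ e = 1) : (envEmbedding ι e)ᴴ * envEmbedding ι e = 1 := by
  ext i j
  simp only [envEmbedding, mul_apply, conjTranspose_apply, of_apply, Fintype.sum_prod_type]
  by_cases h : i = j
  · subst h
    simpa [dotProduct, apply_ite, Finset.sum_ite_eq] using he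
  · simp [h, Ne.symm h, apply_ite]

theorem withEnv_eq_conj [Fintype ι] [DecidableEq ι] (e : κ → ℂ) (X : Matrix ι ι ℂ) :
    withEnv e X = envEmbedding ι e * X * (envEmbedding ι e)ᴴ := by
  ext ⟨i, k⟩ ⟨j, l⟩
  simp [withEnv, envEmbedding, mul_apply, vecMulVec_apply, apply_ite, Finset.sum_ite_eq]
  ring

theorem partialTraceEnv_envEmbedding_mul [Fintype ι] [DecidableEq ι] [Fintype κ] (e : κ → ℂ)
    (Y : Matrix ι (ι × κ) ℂ) :
    partialTraceEnv (envEmbedding ι e * Y) = Y * envEmbedding ι e := by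
  ext i j
  simp [partialTraceEnv, envEmbedding, mul_apply, Fintype.sum_prod_type, mul_comm]

theorem partialTraceEnv_mul_conjTranspose [Fintype ι] [DecidableEq ι] [Fintype κ] (e : κ → ℂ)
    (Y : Matrix (ι × κ) ι ℂ) :
    partialTraceEnv (Y * (envEmbedding ι e)ᴴ) = (envEmbedding ι e)ᴴ * Y := by
  ext i j
  simp [partialTraceEnv, envEmbedding, mul_apply, Fintype.sum_prod_type, mul_comm, apply_ite]

theorem partialTraceEnv_nonneg [Fintype κ] {A : Matrix (ι × κ) (ι × κ) ℂ} (hA : 0 ≤ A) :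
    0 ≤ partialTraceEnv A := by
  have h : partialTraceEnv A = ∑ k, A.submatrix (fun i => (i, k)) (fun i => (i, k)) := by
    ext i j
    simp [partialTraceEnv, Matrix.sum_apply]
  rw [h]
  exact Finset.sum_nonneg fun k _ => (hA.posSemidef.submatrix _).nonneg

theorem trace_partialTraceEnv [Fintype ι] [Fintype κ] (A : Matrix (ι × κ) (ι × κ) ℂ) :
    (partialTraceEnv A).trace = A.trace := by
  simp [partialTraceEnv, trace, Fintype.sum_prod_type]

variable [Fintype ι] [DecidableEq ι] [Fintype κ] [DecidableEq κ]

/-- The compression `⟨e| A |e⟩` is at most `Tr_E A`: with `Q = 1 - 1 ⊗ |e⟩⟨e|` the difference is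
`Tr_E (Q A Q)`. -/
theorem compress_le_partialTraceEnv {e : κ → ℂ} (he : star e ⬝ᵥ e = 1)
    {A : Matrix (ι × κ) (ι × κ) ℂ} (hA : 0 ≤ A) :
    (envEmbedding ι e)ᴴ * A * envEmbedding ι e ≤ partialTraceEnv A := by
  have hW := conjTranspose_envEmbedding_mul_self (ι := ι) he
  set W := envEmbedding ι e with hWdef
  have hadd : ∀ X Y : Matrix (ι × κ) (ι × κ) ℂ,
      partialTraceEnv (X - Y) = partialTraceEnv X - partialTraceEnv Y := by
    intro X Y
    ext i j
    simp [partialTraceEnv]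
  have h := partialTraceEnv_nonneg (conj_nonneg hA (1 - W * Wᴴ))
  have h1 : (1 - W * Wᴴ) * A * (1 - W * Wᴴ)ᴴ
      = A - W * (Wᴴ * A) - (A * W * Wᴴ - W * (Wᴴ * A * W * Wᴴ)) := by
    simp only [conjTranspose_sub, conjTranspose_one, conjTranspose_mul, conjTranspose_conjTranspose,
      Matrix.mul_sub, Matrix.sub_mul, Matrix.mul_one, Matrix.one_mul, Matrix.mul_assoc]
  rw [h1, hadd, hadd, hadd, hWdef, partialTraceEnv_envEmbedding_mul,
    partialTraceEnv_mul_conjTranspose, partialTraceEnv_envEmbedding_mul, ← hWdef,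
    Matrix.mul_assoc (Wᴴ * A * W), hW, Matrix.mul_one, ← Matrix.mul_assoc Wᴴ A W, sub_self,
    sub_zero] at h
  exact sub_nonneg.1 h

/-- Monotonicity of the affinity `Tr √A √B` under `Tr_E` when `B = ρ ⊗ |e⟩⟨e|`. -/
theorem re_trace_sqrt_mul_sqrt_withEnv_le {e : κ → ℂ} (he : star e ⬝ᵥ e = 1)
    {A : Matrix (ι × κ) (ι × κ) ℂ} (hA : 0 ≤ A) {ρ : Matrix ι ι ℂ} (hρ : 0 ≤ ρ) :
    (CFC.sqrt A * CFC.sqrt (withEnv e ρ)).trace.re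
      ≤ (CFC.sqrt (partialTraceEnv A) * CFC.sqrt ρ).trace.re := by
  have hW := conjTranspose_envEmbedding_mul_self (ι := ι) he
  rw [withEnv_eq_conj, sqrt_conj_isometry hρ hW]
  set W := envEmbedding ι e
  have hK : 0 ≤ Wᴴ * CFC.sqrt A * W := by
    simpa using conj_nonneg (CFC.sqrt_nonneg A) Wᴴ
  have htr : (CFC.sqrt A * (W * CFC.sqrt ρ * Wᴴ)).trace
      = (Wᴴ * CFC.sqrt A * W * CFC.sqrt ρ).trace := by
    rw [← Matrix.mul_assoc, trace_mul_comm]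
    simp only [Matrix.mul_assoc]
  rw [htr]
  exact re_trace_mul_le_of_le (le_sqrt_of_mul_self_le hK
    ((mul_self_compress_sqrt_le hA hW).trans (compress_le_partialTraceEnv he hA)))
    (CFC.sqrt_nonneg ρ)

end PartialTrace

/-- On states, the squared Hellinger distance is `2 - 2 Tr √A √B`. -/
theorem hellingerDist_eq {n : Type*} [Fintype n] [DecidableEq n] {A B : Matrix n n ℂ}
    (hA : IsDensityMatrix A) (hB : IsDensityMatrix B) :
    hellingerDist A B = 2 - 2 * (CFC.sqrt A * CFC.sqrt B).trace.re := by
  have h1 := CFC.sqrt_mul_sqrt_self A hA.1.nonneg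
  have h2 := CFC.sqrt_mul_sqrt_self B hB.1.nonneg
  rw [hellingerDist, sq, Matrix.sub_mul, Matrix.mul_sub, Matrix.mul_sub, h1, h2]
  simp only [trace_sub, Complex.sub_re, hA.2, hB.2, trace_mul_comm (CFC.sqrt B), Complex.one_re]
  ring

/-! ### Spectral functions of the permuted Hamiltonian -/

namespace IsOrthogonalDecomposition

variable {κ : Type*} [Fintype κ] [DecidableEq κ] {M : ℕ} {P : Fin M → Matrix κ κ ℂ}

theorem comp_perm (hP : IsOrthogonalDecomposition P) (s : Equiv.Perm (Fin M)) :
    IsOrthogonalDecomposition (P ∘ s) where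
  isHermitian i := hP.isHermitian (s i)
  idempotent i := hP.idempotent (s i)
  ne_zero i := hP.ne_zero (s i)
  orthogonal i j h := hP.orthogonal (s i) (s j) (s.injective.ne h)
  sum_eq_one := by
    rw [← hP.sum_eq_one]
    exact Equiv.sum_comp s P

/-- The functional calculus of an orthogonal decomposition: the algebra homomorphism
`f ↦ ∑ i, f i • P i` on functions on the index set. -/
def functionalCalculus (hP : IsOrthogonalDecomposition P) :
    (Fin M → ℂ) →ₐ[ℂ] Matrix κ κ ℂ :=
  AlgHom.ofLinearMap (Fintype.linearCombination ℂ P)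
    (by simp [Fintype.linearCombination_apply, hP.sum_eq_one])
    (by
      intro f g
      simp only [Fintype.linearCombination_apply, Finset.sum_mul_sum, Matrix.smul_mul,
        Matrix.mul_smul, smul_smul, Pi.mul_apply]
      refine Finset.sum_congr rfl fun i _ => ?_
      rw [Finset.sum_eq_single i]
      · rw [hP.idempotent, mul_comm]
      · intro j _ hj
        rw [hP.orthogonal i j hj.symm, smul_zero]
      · simp)

theorem functionalCalculus_apply (hP : IsOrthogonalDecomposition P) (f : Fin M → ℂ) :
    hP.functionalCalculus f = ∑ i, f i • P i := rfl

theorem conjTranspose_functionalCalculus (hP : IsOrthogonalDecomposition P) (f : Fin M → ℂ) :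
    (hP.functionalCalculus f)ᴴ = hP.functionalCalculus (star f) := by
  simp [functionalCalculus_apply, conjTranspose_sum, (hP.isHermitian _).eq]

open scoped Matrix.Norms.L2Operator in
theorem exp_functionalCalculus (hP : IsOrthogonalDecomposition P) (f : Fin M → ℂ) :
    NormedSpace.exp (hP.functionalCalculus f)
      = hP.functionalCalculus (fun i => Complex.exp (f i)) := by
  have hc : Continuous hP.functionalCalculus :=
    LinearMap.continuous_of_finiteDimensional hP.functionalCalculus.toLinearMap
  rw [← NormedSpace.map_exp hP.functionalCalculus hc]
  congr 1
  ext i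
  rw [Pi.coe_exp, Complex.exp_eq_exp_ℂ]

theorem timeEvolution_permutedHamiltonian (hP : IsOrthogonalDecomposition P) (lam : Fin M → ℝ)
    (s : Equiv.Perm (Fin M)) (T : ℝ) :
    timeEvolution (permutedHamiltonian lam P s) T
      = (hP.comp_perm s).functionalCalculus (fun i => Complex.exp (-(Complex.I * T) * lam i)) := by
  rw [← exp_functionalCalculus, timeEvolution, permutedHamiltonian, functionalCalculus_apply,
    Finset.smul_sum]
  simp only [smul_smul, Function.comp_apply]

theorem conjTranspose_timeEvolution_mul_self (hP : IsOrthogonalDecomposition P) (lam : Fin M → ℝ)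
    (s : Equiv.Perm (Fin M)) (T : ℝ) :
    (timeEvolution (permutedHamiltonian lam P s) T)ᴴ
      * timeEvolution (permutedHamiltonian lam P s) T = 1 := by
  rw [hP.timeEvolution_permutedHamiltonian, conjTranspose_functionalCalculus, ← map_mul]
  rw [← map_one (hP.comp_perm s).functionalCalculus]
  congr 1
  ext i
  simp [← Complex.exp_conj, ← Complex.exp_add]

/-- `Tr (P_k R P_l R)` is real for Hermitian `R`, so only the real parts `cos ((λ_i - λ_j) T)` of
the phases contribute. -/
theorem re_trace_timeEvolution_conj_mul (hP : IsOrthogonalDecomposition P) (lam : Fin M → ℝ)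
    (s : Equiv.Perm (Fin M)) (T : ℝ) {R : Matrix κ κ ℂ} (hR : Rᴴ = R) :
    (timeEvolution (permutedHamiltonian lam P s) T * R
        * (timeEvolution (permutedHamiltonian lam P s) T)ᴴ * R).trace.re
      = ∑ i, ∑ j, Real.cos ((lam i - lam j) * T) * (P (s i) * R * P (s j) * R).trace.re := by
  have him : ∀ k l, (P k * R * P l * R).trace.im = 0 := by
    intro k l
    rw [← Complex.conj_eq_iff_im, starRingEnd_apply, ← trace_conjTranspose]
    simp only [conjTranspose_mul, hR, (hP.isHermitian _).eq]
    rw [trace_mul_comm, Matrix.mul_assoc _ (P l), trace_mul_comm (P k * R)]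
    simp only [Matrix.mul_assoc]
  rw [hP.timeEvolution_permutedHamiltonian, conjTranspose_functionalCalculus,
    functionalCalculus_apply, functionalCalculus_apply]
  simp only [Finset.sum_mul, Finset.mul_sum, trace_sum, Complex.re_sum, Matrix.smul_mul,
    Matrix.mul_smul, trace_smul, smul_eq_mul, Function.comp_apply, Pi.star_apply]
  rw [Finset.sum_comm]
  refine Finset.sum_congr rfl fun i _ => Finset.sum_congr rfl fun j _ => ?_
  have hphase : star (Complex.exp (-(Complex.I * T) * lam j))
      * Complex.exp (-(Complex.I * T) * lam i)
      = Complex.exp ((-((lam i - lam j) * T) : ℝ) * Complex.I) := by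
    rw [← starRingEnd_apply, ← Complex.exp_conj, ← Complex.exp_add]
    congr 1
    simp
    ring
  rw [← mul_assoc, hphase, Complex.mul_re, him, mul_zero, sub_zero, Complex.exp_ofReal_mul_I_re,
    Real.cos_neg]

end IsOrthogonalDecomposition

/-! ### Averages over permutations -/

section Permutations

variable {α : Type*} [Fintype α] [DecidableEq α]

theorem sum_compl_singleton_perm (g : α → α → ℝ) (s : Equiv.Perm α) :
    ∑ i, ∑ j ∈ {i}ᶜ, g (s i) (s j) = ∑ k, ∑ l ∈ {k}ᶜ, g k l := by
  rw [← Equiv.sum_comp s fun k => ∑ l ∈ {k}ᶜ, g k l]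
  exact Finset.sum_congr rfl fun i _ => Finset.sum_equiv s (by simp) (by simp)

/-- All pairs of distinct indices contribute equally to a sum over permutations, because the
symmetric group is doubly transitive. -/
theorem sum_perm_pair_eq (g : α → α → ℝ) {i j : α} (hij : i ≠ j) :
    ∑ s : Equiv.Perm α, g (s i) (s j)
      = (Fintype.card α).factorial * (∑ k, ∑ l ∈ {k}ᶜ, g k l)
        / (Fintype.card α * (Fintype.card α - 1)) := by
  have hconst : ∀ k l : α, k ≠ l →
      ∑ s : Equiv.Perm α, g (s k) (s l) = ∑ s : Equiv.Perm α, g (s i) (s j) := by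
    intro k l hkl
    obtain ⟨t, hti, htj⟩ := MulAction.is_two_pretransitive_iff.1
      (Equiv.Perm.isMultiplyPretransitive α 2) hkl hij
    rw [← Equiv.sum_comp (Equiv.mulRight t) (fun s => g (s k) (s l))]
    simp [← hti, ← htj]
  have hcard : 2 ≤ Fintype.card α := Fintype.one_lt_card_iff.2 ⟨i, j, hij⟩
  have hcard' : (2 : ℝ) ≤ Fintype.card α := by exact_mod_cast hcard
  have htotal : ∑ k, ∑ l ∈ {k}ᶜ, ∑ s : Equiv.Perm α, g (s k) (s l)
      = (Fintype.card α).factorial * (∑ k, ∑ l ∈ {k}ᶜ, g k l) := by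
    simp_rw [Finset.sum_comm (s := {_}ᶜ)]
    rw [Finset.sum_comm]
    simp [sum_compl_singleton_perm, Fintype.card_perm]
  rw [← htotal, eq_div_iff (by nlinarith)]
  have : ∀ k : α, ∑ l ∈ {k}ᶜ, ∑ s : Equiv.Perm α, g (s k) (s l)
      = (Fintype.card α - 1) * ∑ s : Equiv.Perm α, g (s i) (s j) := by
    intro k
    rw [Finset.sum_congr rfl fun l hl => hconst k l (by simpa [eq_comm] using hl)]
    simp [Finset.card_compl, Nat.cast_sub (by omega : 1 ≤ Fintype.card α)]
  simp_rw [this]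
  simp
  ring

end Permutations

/-- `B(T)` as an average over ordered pairs of distinct indices. For `M ≤ 1` both sides are `0`, the
sums being empty. -/
theorem cosAverage_eq {M : ℕ} (lam : Fin M → ℝ) (T : ℝ) :
    cosAverage lam T
      = (∑ i, ∑ j ∈ {i}ᶜ, Real.cos ((lam i - lam j) * T)) / ((M : ℝ) * ((M : ℝ) - 1)) := by
  have h := Finset.sum_sum_Ioi_add_eq_sum_sum_off_diag
    (fun i j : Fin M => Real.cos ((lam j - lam i) * T))
  have hsymm : ∀ i j : Fin M, Real.cos ((lam j - lam i) * T) = Real.cos ((lam i - lam j) * T) := by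
    intro i j
    rw [← Real.cos_neg]
    ring_nf
  rw [← h, cosAverage]
  have hterm : ∀ i j : Fin M, Real.cos ((lam i - lam j) * T) + Real.cos ((lam j - lam i) * T)
      = 2 * Real.cos ((lam i - lam j) * T) := by
    intro i j
    rw [hsymm i j]
    ring
  simp_rw [hterm, ← Finset.mul_sum]
  ring

theorem theorem3 {ι κ : Type*} [Fintype ι] [DecidableEq ι] [Fintype κ] [DecidableEq κ]
    (Φ : Matrix ι ι ℂ →ₗ[ℂ] Matrix ι ι ℂ) (hΦ : IsQuantumChannel Φ)
    (e : κ → ℂ) (he : star e ⬝ᵥ e = 1)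
    (U : Matrix (ι × κ) (ι × κ) ℂ) (hU : U ∈ Matrix.unitaryGroup (ι × κ) ℂ)
    (hStinespring : ∀ X : Matrix ι ι ℂ, Φ X = stinespringMap e U X)
    (T : ℝ) {M : ℕ} (H : Matrix (ι × κ) (ι × κ) ℂ)
    (lam : Fin M → ℝ) (P : Fin M → Matrix (ι × κ) (ι × κ) ℂ)
    (hH : IsSpectralDecomposition H lam P) (hUH : U = timeEvolution H T)
    (ρ : Matrix ι ι ℂ) (hρ : IsDensityMatrix ρ) :
    (1 / (M.factorial : ℝ)) * ∑ s : Equiv.Perm (Fin M),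
        hellingerDist
          (stinespringMap e (timeEvolution (permutedHamiltonian lam P s) T) ρ) ρ
      ≤ 2 * (1 - cosAverage lam T) * coherenceHalf P (withEnv e ρ) := by
  have hP := hH.decomposition
  have hW := conjTranspose_envEmbedding_mul_self (ι := ι) he
  set τ := withEnv e ρ with hτ
  have hτ0 : 0 ≤ τ := by
    rw [hτ, withEnv_eq_conj]
    exact conj_nonneg hρ.1.nonneg _
  have hτ1 : τ.trace = 1 := by
    rw [hτ, withEnv_eq_conj, trace_conj_isometry _ hW, hρ.2]
  set R := CFC.sqrt τ with hRdef
  have hR : Rᴴ = R := (CFC.sqrt_nonneg τ).posSemidef.isHermitian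
  have hRR : R * R = τ := CFC.sqrt_mul_sqrt_self τ hτ0
  set g : Fin M → Fin M → ℝ := fun k l => (P k * R * P l * R).trace.re with hg
  -- Monotonicity under the partial trace enters here; the averaged bound is then evaluated exactly.
  have hle : ∀ s : Equiv.Perm (Fin M),
      hellingerDist (stinespringMap e (timeEvolution (permutedHamiltonian lam P s) T) ρ) ρ
        ≤ 2 - 2 * ∑ i, ∑ j, Real.cos ((lam i - lam j) * T) * g (s i) (s j) := by
    intro s
    rw [hg, ← hP.re_trace_timeEvolution_conj_mul lam s T hR]
    have hV := hP.conjTranspose_timeEvolution_mul_self lam s T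
    set V := timeEvolution (permutedHamiltonian lam P s) T
    have hA : 0 ≤ V * τ * Vᴴ := conj_nonneg hτ0 V
    have hmono := re_trace_sqrt_mul_sqrt_withEnv_le he hA hρ.1.nonneg
    rw [sqrt_conj_isometry hτ0 hV] at hmono
    have hσ : IsDensityMatrix (stinespringMap e V ρ) :=
      ⟨(partialTraceEnv_nonneg hA).posSemidef, by
        rw [stinespringMap, trace_partialTraceEnv, trace_conj_isometry _ hV, ← hτ, hτ1]⟩
    rw [hellingerDist_eq hσ hρ]
    have hmono' : (V * R * Vᴴ * R).trace.re
      ≤ (CFC.sqrt (stinespringMap e V ρ) * CFC.sqrt ρ).trace.re := hmono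
    linarith
  have hdiag : coherenceHalf P τ = 1 - ∑ k, g k k := by
    rw [coherenceHalf]
    congr 1
    refine Finset.sum_congr rfl fun k _ => ?_
    rw [hg, ← hRdef, sq, ← Matrix.mul_assoc, trace_mul_comm]
    simp only [← Matrix.mul_assoc, hP.idempotent]
    rw [Matrix.mul_assoc (P k * R), hP.idempotent]
  have hall : ∑ k, ∑ l, g k l = 1 := by
    have : ∑ k, ∑ l, (P k * R * P l * R) = τ := by
      simp_rw [← Finset.sum_mul, ← Finset.mul_sum, ← Finset.sum_mul, hP.sum_eq_one]
      rw [Matrix.mul_one, Matrix.one_mul, hRR]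
    rw [← Complex.one_re, ← hτ1, ← this]
    simp [trace_sum, hg]
  have hsplit : ∀ f : Fin M → Fin M → ℝ,
      ∑ i, ∑ j, f i j = ∑ i, f i i + ∑ i, ∑ j ∈ {i}ᶜ, f i j := by
    intro f
    rw [← Finset.sum_add_distrib]
    refine Finset.sum_congr rfl fun i _ => ?_
    rw [Fintype.sum_eq_add_sum_compl i]
  have hoff : ∑ k, ∑ l ∈ {k}ᶜ, g k l = coherenceHalf P τ := by
    rw [hdiag, ← hall, hsplit g]
    ring
  have hM : (M.factorial : ℝ) ≠ 0 := by exact_mod_cast M.factorial_ne_zero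
  have havg : ∑ s : Equiv.Perm (Fin M), ∑ i, ∑ j, Real.cos ((lam i - lam j) * T) * g (s i) (s j)
      = M.factorial * ((1 - coherenceHalf P τ) + cosAverage lam T * coherenceHalf P τ) := by
    have hpair : ∀ i, ∀ j ∈ ({i}ᶜ : Finset (Fin M)),
        ∑ s : Equiv.Perm (Fin M), Real.cos ((lam i - lam j) * T) * g (s i) (s j)
          = Real.cos ((lam i - lam j) * T)
            * (M.factorial * coherenceHalf P τ / (M * (M - 1))) := by
      intro i j hj
      rw [← Finset.mul_sum, sum_perm_pair_eq g (by simpa [eq_comm] using hj), hoff,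
        Fintype.card_fin]
    simp_rw [hsplit]
    rw [Finset.sum_add_distrib]
    have h1 : ∑ s : Equiv.Perm (Fin M), ∑ i, Real.cos ((lam i - lam i) * T) * g (s i) (s i)
        = M.factorial * (1 - coherenceHalf P τ) := by
      have : ∀ s : Equiv.Perm (Fin M), ∑ i, g (s i) (s i) = ∑ k, g k k := fun s =>
        Equiv.sum_comp s fun k => g k k
      simp [this, hdiag, Fintype.card_perm]
    have h2 : ∑ s : Equiv.Perm (Fin M), ∑ i, ∑ j ∈ {i}ᶜ,
        Real.cos ((lam i - lam j) * T) * g (s i) (s j)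
          = M.factorial * (cosAverage lam T * coherenceHalf P τ) := by
      rw [Finset.sum_comm]
      simp_rw [Finset.sum_comm (s := (Finset.univ : Finset (Equiv.Perm (Fin M))))]
      rw [Finset.sum_congr rfl fun i _ => Finset.sum_congr rfl (hpair i)]
      simp_rw [← Finset.sum_mul]
      rw [cosAverage_eq]
      ring
    rw [h1, h2]
    ring
  calc (1 / (M.factorial : ℝ)) * ∑ s : Equiv.Perm (Fin M),
        hellingerDist (stinespringMap e (timeEvolution (permutedHamiltonian lam P s) T) ρ) ρ
      ≤ (1 / (M.factorial : ℝ)) * ∑ s : Equiv.Perm (Fin M),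
          (2 - 2 * ∑ i, ∑ j, Real.cos ((lam i - lam j) * T) * g (s i) (s j)) :=
        mul_le_mul_of_nonneg_left (Finset.sum_le_sum fun s _ => hle s) (by positivity)
    _ = 2 * (1 - cosAverage lam T) * coherenceHalf P τ := by
        rw [Finset.sum_sub_distrib, ← Finset.mul_sum, havg]
        simp only [Finset.sum_const, Finset.card_univ, Fintype.card_perm, Fintype.card_fin,
          nsmul_eq_mul]
        field_simp
        ring
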